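/- For complex numbers $w,z$ with $\operatorname{Re}(w)>-1$ let $$\binom{w}{z}=\frac{\Gamma(w+1)}{\Gamma(z+1)\,\Gamma(w-z+1)},$$ where $1/\Gamma$ denotes the entire reciprocal Gamma function (equal to $0$ at $0,-1,-2,\dots$), and for $p,q\in\mathbb{C}\setminus\{0,-1,-2,\dots\}$ let $$B(p,q)=\frac{\Gamma(p)\,\Gamma(q)}{\Gamma(p+q)}$$ be Euler's beta function. Let $w,\alpha\in\mathbb{C}$ with $\operatorname{Re}(w)>-1$, and suppose that either $\operatorname{Im}(\alpha)>0$ or $\alpha$ is a positive integer. Then the function $x\mapsto\binom{w}{x}\frac{1}{x+\alpha}$ is Lebesgue integrable on $\mathbb{R}$, the series $\sum_{k\ge 0}\binom{w}{k}\frac{1}{k+\alpha}$ converges absolutely, and $$\int_{-\infty}^{\infty}\binom{w}{x}\frac{1}{x+\alpha}\,dx=\sum_{k=0}^{\infty}\binom{w}{k}\frac{1}{k+\alpha}-e^{i\pi\alpha}B(w+1,\alpha).$$ (If $\alpha$ is a positive integer, the integrand is left undefined at the single point $x=-\alpha$, a removable singularity.) -/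

import Mathlib

/-- The binomial coefficient with two complex arguments,
`Γ(w + 1) / (Γ(z + 1) Γ(w - z + 1))` for `w` not a negative integer. Here `1 / Γ` is the entire
reciprocal Gamma function, which vanishes at `0, -1, -2, …`; Mathlib's `Complex.Gamma` is `0`
there, so the quotient below has the correct value `0` at these points. -/
noncomputable def complexBinom (w z : ℂ) : ℂ :=
  Complex.Gamma (w + 1) / (Complex.Gamma (z + 1) * Complex.Gamma (w - z + 1))

/-- Euler's beta function, meromorphically continued: `Γ(p) Γ(q) / Γ(p + q)` for `p, q` not in
`{0, -1, -2, …}`. If `p + q` is a pole of `Γ`, the value is `0`, as it should be. (The Euler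
integral `Complex.betaIntegral p q` would only do for `0 < re p` and `0 < re q`.) -/
noncomputable def complexBeta (p q : ℂ) : ℂ :=
  Complex.Gamma p * Complex.Gamma q / Complex.Gamma (p + q)

/-! ### Half-circle integrals: a dominating function and continuity up to the unit circle. -/

namespace ComplexBinom

open Complex MeasureTheory Set Filter Topology intervalIntegral

/-! Both sides equal `-I * arcIntegral w α π 1`, an integral of `(1 + u)^w u^(α-1)` over the upper
unit semicircle.

Integral side: `complexBinom w x` is the Fourier coefficient `(2π)⁻¹ ∫ (1 + e^{is})^w e^{-isx} ds`
over `(-π, π)`, for every real `x`. For `Im α > 0`, `1/(x+α)` is the Fourier transform of an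
exponential supported on a half-line. Fourier inversion at `0`, applied to the convolution of the
two kernels, gives the integral of the product; the half-line support keeps only half of the circle.
Positive integers `α = n` are reached as limits of `n + iε` (`integral_eq_arcIntegral`).

Series side: for `Re α > 0`, Cauchy's theorem moves the semicircle to the diameter
(`I_mul_arcIntegral_one`). The radius `[0,1]` gives `∫ t^(α-1) (1+t)^w dt`, which is the series
after termwise integration; the radius `[-1,0]` gives `e^{iπα} B(w+1, α)`. The identity theorem
carries this to the half-plane `Im α > 0` (`arcIntegral_eq_tsum`).

The Fourier coefficient formula comes from the same contour argument: subtracting the lower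
semicircle from the upper one leaves only a sine times a beta function, which is the binomial
coefficient by the reflection formula. That formula also gives the power decay in `x` behind
integrability and absolute convergence. -/

lemma one_add_mul_exp_mem_slitPlane {r s : ℝ} (hr0 : 0 ≤ r) (hr1 : r ≤ 1) (hs : |s| < Real.pi) :
    1 + (r : ℂ) * exp (s * I) ∈ slitPlane := by
  rcases hr1.lt_or_eq with h | rfl
  · refine mem_slitPlane_of_norm_lt_one ?_
    rw [norm_mul, norm_exp_ofReal_mul_I, mul_one, norm_real, Real.norm_of_nonneg hr0]
    exact h
  · rw [ofReal_one, one_mul, mem_slitPlane_iff]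
    rw [abs_lt] at hs
    by_cases h0 : s = 0
    · left; simp [h0]
    · right
      rw [add_im, one_im, zero_add, exp_ofReal_mul_I_im]
      intro h
      exact h0 ((Real.sin_eq_zero_iff_of_lt_of_lt hs.1 hs.2).1 h)

/-- Jordan's inequality bounds the left side by `cos (|s|/2)`, whose square is `(1 + cos s)/2`. The
squared norm `1 + 2r cos s + r²` is at least `1` if `cos s ≥ 0`, and at least `sin² s = (1 - cos
s)(1 + cos s)` otherwise. The bound is uniform in `r` and vanishes only linearly at `s = ±π`, so its
power `w.re > -1` is integrable. -/
lemma one_sub_div_pi_le_norm {r s : ℝ} (hr0 : 0 ≤ r) (hs : |s| ≤ Real.pi) :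
    1 - |s| / Real.pi ≤ ‖1 + (r : ℂ) * exp (s * I)‖ := by
  have h1 : 1 - |s| / Real.pi ≤ Real.cos (|s| / 2) := by
    have := Real.one_sub_mul_le_cos (x := |s| / 2) (by positivity) (by linarith)
    calc _ = 1 - 2 / Real.pi * (|s| / 2) := by ring
      _ ≤ _ := this
  refine h1.trans (Real.le_sqrt_of_sq_le ?_)
  rw [normSq_apply]
  have hre : (1 + (r : ℂ) * exp (s * I)).re = 1 + r * Real.cos s := by
    rw [add_re, one_re, re_ofReal_mul, exp_ofReal_mul_I_re]
  have him : (1 + (r : ℂ) * exp (s * I)).im = r * Real.sin s := by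
    rw [add_im, one_im, im_ofReal_mul, exp_ofReal_mul_I_im, zero_add]
  rw [hre, him, Real.cos_sq, mul_div_cancel₀ _ two_ne_zero, Real.cos_abs]
  have hc1 := Real.cos_le_one s
  have hc2 := Real.neg_one_le_cos s
  have hsc := Real.sin_sq_add_cos_sq s
  by_cases hc : 0 ≤ Real.cos s
  · nlinarith [mul_nonneg hr0 hc, sq_nonneg r]
  · push Not at hc
    have h : (1 + r * Real.cos s) * (1 + r * Real.cos s) + r * Real.sin s * (r * Real.sin s) =
        1 + 2 * r * Real.cos s + r ^ 2 := by linear_combination r ^ 2 * hsc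
    rw [h]
    nlinarith [sq_nonneg (r + Real.cos s),
      mul_nonneg (by linarith : 0 ≤ 1 / 2 - Real.cos s) (neg_le_iff_add_nonneg'.1 hc2)]

lemma norm_cpow_one_add_le (w : ℂ) {r s : ℝ} (hr0 : 0 ≤ r) (hr1 : r ≤ 1) (hs : |s| < Real.pi) :
    ‖(1 + (r : ℂ) * exp (s * I)) ^ w‖ ≤
      Real.exp (Real.pi * |w.im|) * (2 ^ |w.re| + (1 - |s| / Real.pi) ^ w.re) := by
  set z := 1 + (r : ℂ) * exp (s * I)
  have hz : 1 - |s| / Real.pi ≤ ‖z‖ := one_sub_div_pi_le_norm hr0 hs.le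
  have hpos : 0 < 1 - |s| / Real.pi := by
    rw [sub_pos, div_lt_one Real.pi_pos]; exact hs
  have hz2 : ‖z‖ ≤ 2 := by
    calc ‖z‖ ≤ ‖(1 : ℂ)‖ + ‖(r : ℂ) * exp (s * I)‖ := norm_add_le _ _
      _ ≤ 1 + 1 := by
        rw [norm_mul, norm_exp_ofReal_mul_I, mul_one, norm_real, Real.norm_of_nonneg hr0, norm_one]
        linarith
      _ = 2 := by norm_num
  have hz0 : 0 < ‖z‖ := hpos.trans_le hz
  -- The first summand covers `Re w ≥ 0`, the second `Re w ≤ 0`; their sum avoids a case split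
  -- later.
  have hmain : ‖z‖ ^ w.re ≤ 2 ^ |w.re| + (1 - |s| / Real.pi) ^ w.re := by
    rcases le_total 0 w.re with h | h
    · rw [abs_of_nonneg h]
      have := Real.rpow_le_rpow hz0.le hz2 h
      have := Real.rpow_nonneg hpos.le w.re
      linarith
    · have h1 := Real.rpow_le_rpow_of_nonpos hpos hz h
      have : (0 : ℝ) ≤ 2 ^ |w.re| := by positivity
      linarith
  rw [norm_cpow_of_ne_zero (norm_pos_iff.1 hz0), div_eq_mul_inv, ← Real.exp_neg, mul_comm]
  refine mul_le_mul (Real.exp_le_exp.2 ?_) hmain (by positivity) (by positivity)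
  calc -(arg z * w.im) ≤ |arg z * w.im| := neg_le_abs _
    _ = |arg z| * |w.im| := abs_mul _ _
    _ ≤ _ := by gcongr; exact abs_arg_le_pi z

/-- Lets the upper (`θ = π`) and lower (`θ = -π`) semicircles be treated together, with `s / θ`
running from `0` to `1` on both. -/
lemma abs_lt_pi_of_mem_uIoc {θ s : ℝ} (hθ : |θ| = Real.pi) (hs : s ∈ uIoc 0 θ) (hne : s ≠ θ) :
    |s| < Real.pi ∧ |s| / Real.pi = s / θ := by
  have hpi := Real.pi_pos
  rcases abs_choice θ with h | h
  · have : θ = Real.pi := by linarith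
    subst this
    rw [uIoc_of_le hpi.le] at hs
    rw [abs_of_pos hs.1]
    exact ⟨lt_of_le_of_ne hs.2 hne, rfl⟩
  · have : θ = -Real.pi := by linarith
    subst this
    rw [uIoc_of_ge (by linarith)] at hs
    rw [abs_of_nonpos hs.2]
    exact ⟨by have := lt_of_le_of_ne hs.1.le (by simpa using hne.symm); linarith, by field_simp⟩

/-- A dominating function for the integrand of `arcIntegral`. -/
noncomputable def arcBound (w α : ℂ) (θ s : ℝ) : ℝ :=
  (Real.exp (Real.pi * |w.im|) * Real.exp (Real.pi * |α.im|)) *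
    (2 ^ |w.re| + (1 - s / θ) ^ w.re)

lemma intervalIntegrable_arcBound {w : ℂ} (hw : -1 < w.re) (α : ℂ) (θ : ℝ) :
    IntervalIntegrable (arcBound w α θ) volume 0 θ := by
  refine (intervalIntegrable_const.add ?_).const_mul _
  have h1 : IntervalIntegrable (fun x : ℝ => (1 - x) ^ w.re) volume 0 1 := by
    have := (intervalIntegrable_rpow' (a := 1) (b := 0) hw).comp_sub_left 1
    simpa using this
  have := h1.comp_mul_left (c := θ⁻¹)
  simpa [div_eq_mul_inv, mul_comm] using this

lemma ae_arc {θ : ℝ} (hθ : |θ| = Real.pi) : ∀ᵐ s : ℝ, s ∈ uIoc 0 θ →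
    |s| < Real.pi ∧ |s| / Real.pi = s / θ := by
  filter_upwards [compl_mem_ae_iff.2 (measure_singleton θ)] with s hne hs
  exact abs_lt_pi_of_mem_uIoc hθ hs hne

lemma aestronglyMeasurable_arc (w α : ℂ) {r θ : ℝ} :
    AEStronglyMeasurable (fun s : ℝ => (1 + (r : ℂ) * exp (s * I)) ^ w * exp (s * I * α))
      (volume.restrict (uIoc 0 θ)) := by
  have : Measurable (fun s : ℝ => (1 + (r : ℂ) * exp (s * I)) ^ w * exp (s * I * α)) := by
    fun_prop
  exact this.aestronglyMeasurable

lemma norm_exp_arc_le {α : ℂ} {s : ℝ} (hs : |s| ≤ Real.pi) :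
    ‖exp (s * I * α)‖ ≤ Real.exp (Real.pi * |α.im|) := by
  rw [norm_exp]
  refine Real.exp_le_exp.2 ?_
  have : (s * I * α).re = -(s * α.im) := by simp [mul_re]
  rw [this]
  calc -(s * α.im) ≤ |s * α.im| := neg_le_abs _
    _ = |s| * |α.im| := abs_mul _ _
    _ ≤ _ := by gcongr

lemma norm_arc_le (w α : ℂ) {r s θ : ℝ} (hr0 : 0 ≤ r) (hr1 : r ≤ 1)
    (hs : |s| < Real.pi ∧ |s| / Real.pi = s / θ) :
    ‖(1 + (r : ℂ) * exp (s * I)) ^ w * exp (s * I * α)‖ ≤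
      arcBound w α θ s := by
  have h1 := norm_cpow_one_add_le w hr0 hr1 hs.1
  have h2 := norm_exp_arc_le (α := α) hs.1.le
  rw [hs.2] at h1
  rw [norm_mul, arcBound]
  exact (mul_le_mul h1 h2 (norm_nonneg _) ((norm_nonneg _).trans h1)).trans_eq (by ring)

/-- `∫ (1 + r e^{is})^w e^{isα} ds` over `0 ≤ s ≤ θ`. -/
noncomputable def arcIntegral (w α : ℂ) (θ r : ℝ) : ℂ :=
  ∫ s in (0 : ℝ)..θ, (1 + (r : ℂ) * exp (s * I)) ^ w * exp (s * I * α)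

lemma intervalIntegrable_arc {w : ℂ} (hw : -1 < w.re) (α : ℂ) {θ : ℝ} (hθ : |θ| = Real.pi) {r : ℝ}
    (hr0 : 0 ≤ r) (hr1 : r ≤ 1) :
    IntervalIntegrable (fun s : ℝ => (1 + (r : ℂ) * exp (s * I)) ^ w * exp (s * I * α))
      volume 0 θ := by
  refine (intervalIntegrable_arcBound hw α θ).mono_fun'
    (aestronglyMeasurable_arc w α) ?_
  refine (ae_restrict_iff' measurableSet_uIoc).2 ?_
  filter_upwards [ae_arc hθ] with s hs hmem
  exact norm_arc_le w α hr0 hr1 (hs hmem)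

lemma continuousOn_arcIntegral {w : ℂ} (hw : -1 < w.re) (α : ℂ) {θ : ℝ} (hθ : |θ| = Real.pi) :
    ContinuousOn (arcIntegral w α θ) (Icc 0 1) := by
  intro r hr
  refine continuousWithinAt_of_dominated_interval (.of_forall fun r => aestronglyMeasurable_arc w α)
    ?_ (intervalIntegrable_arcBound hw α θ) ?_
  · filter_upwards [self_mem_nhdsWithin] with r hr
    filter_upwards [ae_arc hθ] with s hs hmem
    exact norm_arc_le w α hr.1 hr.2 (hs hmem)
  · filter_upwards [ae_arc hθ] with s hs hmem
    refine ContinuousWithinAt.mul ?_ continuousWithinAt_const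
    refine ContinuousAt.continuousWithinAt ?_
    refine ContinuousAt.cpow (by fun_prop) continuousAt_const ?_
    exact one_add_mul_exp_mem_slitPlane hr.1 hr.2 (hs hmem).1

end ComplexBinom

/-! ### Contour deformation from a semicircle to the diameter. -/

namespace ComplexBinom

open Complex MeasureTheory Set Filter Topology intervalIntegral

lemma exp_theta_mul_I {θ : ℝ} (hθ : |θ| = Real.pi) : exp (θ * I) = -1 := by
  rcases abs_choice θ with h | h
  · rw [show θ = Real.pi by linarith, exp_pi_mul_I]
  · rw [show θ = -Real.pi by linarith, ofReal_neg, neg_mul, exp_neg, exp_pi_mul_I]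
    norm_num

lemma one_add_mul_mem_slitPlane {c : ℂ} (hc : ‖c‖ ≤ 1) {t : ℝ} (ht : t ∈ Ioo (0 : ℝ) 1) :
    1 + c * (t : ℂ) ∈ slitPlane := by
  refine mem_slitPlane_of_norm_lt_one ?_
  rw [norm_mul, norm_real, Real.norm_of_nonneg ht.1.le]
  nlinarith [ht.1, ht.2, norm_nonneg c]

lemma integral_exp_substitution (w α c : ℂ) (hc : ‖c‖ ≤ 1) {p q : ℝ} (hp : p < 0) (hq : q < 0) :
    ∫ x in p..q, (1 + c * exp x) ^ w * exp (α * x) =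
      ∫ t in Real.exp p..Real.exp q, (t : ℂ) ^ (α - 1) * (1 + c * t) ^ w := by
  have hmem : ∀ x ∈ uIcc p q, Real.exp x ∈ Ioo (0 : ℝ) 1 := fun x hx =>
    ⟨Real.exp_pos x, Real.exp_lt_one_iff.2 (hx.2.trans_lt (max_lt hp hq))⟩
  have := integral_deriv_smul_comp' (a := p) (b := q) (f := Real.exp) (f' := Real.exp)
    (g := fun t : ℝ => (t : ℂ) ^ (α - 1) * (1 + c * t) ^ w)
    (fun x _ => Real.hasDerivAt_exp x) Real.continuous_exp.continuousOn ?_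
  · rw [← this]
    refine integral_congr fun x _ => ?_
    simp only [Function.comp, real_smul, ofReal_exp]
    rw [cpow_def_of_ne_zero (exp_ne_zero _), ← ofReal_exp, ← ofReal_log (Real.exp_pos x).le,
      Real.log_exp, ofReal_exp, ← mul_assoc, ← exp_add, mul_comm]
    ring_nf
  · rintro _ ⟨x, hx, rfl⟩
    refine ContinuousAt.continuousWithinAt ?_
    refine ContinuousAt.mul ?_ ?_
    · refine (continuousAt_ofReal_cpow_const _ _ ?_)
      exact Or.inr (hmem x hx).1.ne'
    · exact ContinuousAt.cpow (by fun_prop) continuousAt_const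
        (one_add_mul_mem_slitPlane hc (hmem x hx))

/-- Cauchy's theorem for a half-annulus in the logarithmic coordinate `u`, where it becomes a
rectangle and `t^α` becomes the entire function `e^{αu}`, so no branch of the power is needed. Since
`p, q < 0`, `|e^u| < 1` keeps `1 + e^u` in the slit plane; on the far edge `e^{iθ} = -1` produces `1
- t`. -/
lemma rectangle_identity (w α : ℂ) {θ : ℝ} (hθ : |θ| = Real.pi) {p q : ℝ} (hp : p < 0)
    (hq : q < 0) :
    (∫ t in Real.exp p..Real.exp q, (t : ℂ) ^ (α - 1) * (1 + 1 * t) ^ w) -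
      exp (θ * I * α) * (∫ t in Real.exp p..Real.exp q, (t : ℂ) ^ (α - 1) * (1 + -1 * t) ^ w) +
      I * (((Real.exp q : ℝ) : ℂ) ^ α * arcIntegral w α θ (Real.exp q)) -
      I * (((Real.exp p : ℝ) : ℂ) ^ α * arcIntegral w α θ (Real.exp p)) = 0 := by
  have key := integral_boundary_rect_eq_zero_of_differentiableOn
    (fun u => (1 + exp u) ^ w * exp (α * u)) (p + (0 : ℝ) * I) (q + θ * I) ?_
  · simp only [add_re, add_im, ofReal_re, ofReal_im, re_ofReal_mul, im_ofReal_mul, I_re, I_im,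
      mul_zero, mul_one, add_zero, zero_add, ofReal_zero, zero_mul] at key
    have h1 := integral_exp_substitution w α 1 (by simp) hp hq
    have h2 := integral_exp_substitution w α (-1) (by simp) hp hq
    have harc : ∀ r : ℝ, ((Real.exp r : ℝ) : ℂ) ^ α * arcIntegral w α θ (Real.exp r) =
        ∫ y in (0 : ℝ)..θ, (1 + exp (r + y * I)) ^ w * exp (α * (r + y * I)) := by
      intro r
      rw [arcIntegral, ← intervalIntegral.integral_const_mul]
      refine integral_congr fun y _ => ?_
      simp only [ofReal_exp]
      rw [cpow_def_of_ne_zero (exp_ne_zero _), ← ofReal_exp, ← ofReal_log (Real.exp_pos r).le,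
        Real.log_exp, ofReal_exp, ← exp_add, mul_left_comm, ← exp_add]
      ring_nf
    rw [harc, harc, ← h1, ← h2, ← intervalIntegral.integral_const_mul]
    rw [← key]
    simp only [smul_eq_mul, one_mul]
    congr 3
    refine integral_congr fun x _ => ?_
    rw [exp_add, exp_theta_mul_I hθ, mul_left_comm, ← exp_add]
    ring_nf
  · intro u hu
    rw [mem_reProdIm] at hu
    simp only [add_re, ofReal_re, re_ofReal_mul, I_re, mul_zero, add_zero] at hu
    refine DifferentiableAt.differentiableWithinAt ?_
    refine DifferentiableAt.mul (DifferentiableAt.cpow_const (by fun_prop) ?_) (by fun_prop)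
    refine mem_slitPlane_of_norm_lt_one ?_
    rw [norm_exp]
    exact Real.exp_lt_one_iff.2 (hu.1.2.trans_lt (max_lt hp hq))

/-- `∫₀¹ t^(α-1) (1 + t)^w dt`. -/
noncomputable def plusIntegral (w α : ℂ) : ℂ :=
  ∫ t in (0 : ℝ)..1, (t : ℂ) ^ (α - 1) * (1 + 1 * t) ^ w

lemma intervalIntegrable_plus (w : ℂ) {α : ℂ} (hα : 0 < α.re) :
    IntervalIntegrable (fun t : ℝ => (t : ℂ) ^ (α - 1) * (1 + 1 * t) ^ w) volume 0 1 := by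
  refine (intervalIntegrable_cpow' (by simpa using hα)).mul_continuousOn ?_
  intro t ht
  rw [uIcc_of_le zero_le_one] at ht
  refine (ContinuousAt.cpow (by fun_prop) continuousAt_const ?_).continuousWithinAt
  refine mem_slitPlane_iff.2 (Or.inl ?_)
  simp only [one_mul, add_re, one_re, ofReal_re]
  linarith [ht.1]

lemma intervalIntegrable_minus {w α : ℂ} (hw : -1 < w.re) (hα : 0 < α.re) :
    IntervalIntegrable (fun t : ℝ => (t : ℂ) ^ (α - 1) * (1 + -1 * t) ^ w) volume 0 1 := by
  have := betaIntegral_convergent (u := α) (v := w + 1) hα (by simp; linarith)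
  simpa [sub_eq_add_neg] using this

lemma integral_minus {w α : ℂ} (hw : -1 < w.re) (hα : 0 < α.re) :
    ∫ t in (0 : ℝ)..1, (t : ℂ) ^ (α - 1) * (1 + -1 * t) ^ w = complexBeta (w + 1) α := by
  have := betaIntegral_eq_Gamma_mul_div α (w + 1) hα (by simp; linarith)
  rw [complexBeta, add_comm _ α, mul_comm (Gamma (w + 1)), ← this, betaIntegral]
  simp [sub_eq_add_neg]

/-- The integral over a half of the unit circle, by contour deformation to the diameter. -/
theorem I_mul_arcIntegral_one {w α : ℂ} (hw : -1 < w.re) (hα : 0 < α.re) {θ : ℝ}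
    (hθ : |θ| = Real.pi) :
    I * arcIntegral w α θ 1 = exp (θ * I * α) * complexBeta (w + 1) α - plusIntegral w α := by
  -- `D r` is the contour integral around the half-disc of radius `r`. It is constant on `(0,1)` and
  -- continuous on `[0,1]`, which absorbs both the singularity at `0` and the one at `-1`; `D 0 = 0`
  -- because `0 ^ α = 0`.
  set D : ℝ → ℂ := fun r =>
    (∫ t in (0 : ℝ)..r, (t : ℂ) ^ (α - 1) * (1 + 1 * t) ^ w) -
      exp (θ * I * α) * (∫ t in (0 : ℝ)..r, (t : ℂ) ^ (α - 1) * (1 + -1 * t) ^ w) +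
      I * ((r : ℂ) ^ α * arcIntegral w α θ r) with hD
  have hi1 := intervalIntegrable_plus w hα
  have hi2 := intervalIntegrable_minus hw hα
  have hsub : ∀ {r}, r ∈ Ioo (0 : ℝ) 1 → uIcc 0 r ⊆ uIcc (0 : ℝ) 1 := fun {r} hr =>
    uIcc_subset_uIcc_left (by rw [uIcc_of_le zero_le_one]; exact ⟨hr.1.le, hr.2.le⟩)
  have hcont : ContinuousOn D (Icc 0 1) := by
    have h1 := continuousOn_primitive_interval' hi1 left_mem_uIcc
    have h2 := continuousOn_primitive_interval' hi2 left_mem_uIcc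
    rw [uIcc_of_le zero_le_one] at h1 h2
    refine (h1.sub (h2.const_mul _)).add (ContinuousOn.const_mul ?_ _)
    refine ContinuousOn.mul ?_ (continuousOn_arcIntegral hw α hθ)
    exact (continuous_ofReal_cpow_const hα).continuousOn
  have hconst : ∀ a ∈ Ioo (0 : ℝ) 1, D a = D (1 / 2) := by
    intro a ha
    have hhalf : (1 / 2 : ℝ) ∈ Ioo (0 : ℝ) 1 := by norm_num
    have key := rectangle_identity w α hθ (p := Real.log (1 / 2)) (q := Real.log a)
      (Real.log_neg hhalf.1 hhalf.2) (Real.log_neg ha.1 ha.2)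
    rw [Real.exp_log ha.1, Real.exp_log hhalf.1,
      ← integral_interval_sub_left (hi1.mono_set (hsub ha)) (hi1.mono_set (hsub hhalf)),
      ← integral_interval_sub_left (hi2.mono_set (hsub ha)) (hi2.mono_set (hsub hhalf))] at key
    simp only [hD]
    linear_combination key
  have hconst' : EqOn D (fun _ => D (1 / 2)) (Icc 0 1) := by
    refine EqOn.of_subset_closure hconst hcont continuousOn_const Ioo_subset_Icc_self ?_
    rw [closure_Ioo zero_ne_one]
  have h01 : D 1 = D 0 :=
    (hconst' (right_mem_Icc.2 zero_le_one)).trans (hconst' (left_mem_Icc.2 zero_le_one)).symm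
  simp only [hD, integral_same, ofReal_zero, ofReal_one, one_cpow, one_mul] at h01
  rw [zero_cpow (by rintro rfl; simp at hα)] at h01
  have h2 := integral_minus hw hα
  have h1 : plusIntegral w α = ∫ t in (0 : ℝ)..1, (t : ℂ) ^ (α - 1) * (1 + t) ^ w := by
    simp [plusIntegral]
  rw [h1, ← h2]
  linear_combination h01

lemma differentiable_arcIntegral {w : ℂ} (hw : -1 < w.re) {θ : ℝ} (hθ : |θ| = Real.pi) :
    Differentiable ℂ fun α => arcIntegral w α θ 1 := by
  intro α
  refine (hasDerivAt_integral_of_dominated_loc_of_deriv_le (s := Metric.ball α 1)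
    (F' := fun α (s : ℝ) =>
      (1 + ((1 : ℝ) : ℂ) * exp (s * I)) ^ w * (exp (s * I * α) * (s * I)))
    -- On the unit ball around `α` the exponential is at most `e^{π(‖α‖+1)}`, and the factor `s * I`
    -- from differentiation has norm at most `π`.
    (bound := fun s => Real.exp (Real.pi * (‖α‖ + 1)) * Real.pi * arcBound w 0 θ s)
    (Metric.ball_mem_nhds α one_pos) (.of_forall fun α => aestronglyMeasurable_arc w α)
    (intervalIntegrable_arc hw α hθ zero_le_one le_rfl) ?_ ?_
    ((intervalIntegrable_arcBound hw 0 θ).const_mul _) ?_).2.differentiableAt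
  · refine Measurable.aestronglyMeasurable ?_
    fun_prop
  · filter_upwards [ae_arc hθ] with s hs hmem β hβ
    have h1 := norm_arc_le w 0 zero_le_one le_rfl (hs hmem)
    have h2 := norm_exp_arc_le (α := β) (hs hmem).1.le
    rw [mul_zero, exp_zero, mul_one] at h1
    have h3 : ‖(s : ℂ) * I‖ ≤ Real.pi := by
      rw [norm_mul, norm_I, mul_one, norm_real]
      exact (hs hmem).1.le
    have h4 : ‖β‖ ≤ ‖α‖ + 1 := by
      have := norm_le_norm_add_norm_sub' β α
      rw [mem_ball_iff_norm] at hβ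
      linarith
    have h5 : ‖exp (s * I * β)‖ ≤ Real.exp (Real.pi * (‖α‖ + 1)) := by
      refine h2.trans (Real.exp_le_exp.2 ?_)
      have := (abs_im_le_norm β).trans h4
      gcongr
    rw [norm_mul, norm_mul, mul_comm]
    gcongr
  · filter_upwards with s _ β _
    refine HasDerivAt.const_mul _ (HasDerivAt.cexp ?_)
    simpa using (hasDerivAt_id β).const_mul ((s : ℂ) * I)

end ComplexBinom

/-! ### The binomial coefficient as an entire function: Fourier coefficients, decay, integrability.
-/

namespace ComplexBinom

open Complex MeasureTheory Set Filter Topology intervalIntegral Asymptotics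

lemma complexBinom_symm (w z : ℂ) : complexBinom w (w - z) = complexBinom w z := by
  rw [complexBinom, complexBinom, sub_sub_cancel, mul_comm (Gamma (z + 1))]

lemma complexBinom_eq_inv (w z : ℂ) :
    complexBinom w z = Gamma (w + 1) * (Gamma (z + 1))⁻¹ * (Gamma (w - z + 1))⁻¹ := by
  rw [complexBinom, div_eq_mul_inv, mul_inv, mul_assoc]

lemma differentiable_complexBinom (w : ℂ) : Differentiable ℂ (complexBinom w) := by
  have h1 : Differentiable ℂ fun z : ℂ => (Gamma (z + 1))⁻¹ :=
    differentiable_one_div_Gamma.comp (differentiable_id.add_const 1)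
  have h2 : Differentiable ℂ fun z : ℂ => (Gamma (w - z + 1))⁻¹ :=
    differentiable_one_div_Gamma.comp ((differentiable_id.const_sub w).add_const 1)
  rw [funext (complexBinom_eq_inv w)]
  exact (h1.const_mul _).mul h2

/-- The reflection formula for the binomial coefficient. -/
lemma complexBinom_eq_beta (w : ℂ) {z : ℂ} (hz : z.re < 0) :
    complexBinom w z = -sin (Real.pi * z) / Real.pi * complexBeta (w + 1) (-z) := by
  have hrefl := Gamma_mul_Gamma_one_sub (-z)
  have hG : Gamma (-z) ≠ 0 := Gamma_ne_zero_of_re_pos (by simpa using hz)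
  have hpi : (Real.pi : ℂ) ≠ 0 := ofReal_ne_zero.2 Real.pi_ne_zero
  rw [mul_neg, sin_neg, sub_neg_eq_add, add_comm 1 z] at hrefl
  rw [complexBeta, complexBinom_eq_inv, show w + 1 + -z = w - z + 1 by ring]
  by_cases hs : sin (Real.pi * z) = 0
  -- Here `z` is a negative integer. Division by zero turns the reflection formula into `Γ(-z)
  -- Γ(z+1) = 0`, which yields the default value `Γ(z+1) = 0`, and both sides vanish.
  · rw [hs, neg_zero, div_zero, mul_eq_zero, or_iff_right hG] at hrefl
    rw [hrefl, hs]
    simp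
  · have h1 : (Gamma (z + 1))⁻¹ = -sin (Real.pi * z) / Real.pi * Gamma (-z) := by
      refine inv_eq_of_mul_eq_one_left ?_
      rw [mul_assoc, hrefl]
      field_simp
    rw [h1]
    ring

/-- For `Re z < 0` both semicircles deform to the diameter; the `plusIntegral` terms cancel and the
reflection formula applies. Both sides are entire in `z`, so agreement near `-1` suffices. -/
lemma complexBinom_eq_arcIntegral_sub {w : ℂ} (hw : -1 < w.re) (z : ℂ) :
    complexBinom w z =
      (2 * Real.pi : ℂ)⁻¹ * (arcIntegral w (-z) Real.pi 1 - arcIntegral w (-z) (-Real.pi) 1) := by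
  have hpi : |Real.pi| = Real.pi := abs_of_pos Real.pi_pos
  have hpi' : |-Real.pi| = Real.pi := by rw [abs_neg, hpi]
  have hd : Differentiable ℂ fun z => (2 * Real.pi : ℂ)⁻¹ *
      (arcIntegral w (-z) Real.pi 1 - arcIntegral w (-z) (-Real.pi) 1) :=
    (((differentiable_arcIntegral hw hpi).comp differentiable_neg).sub
      ((differentiable_arcIntegral hw hpi').comp differentiable_neg)).const_mul _
  have heq : ∀ᶠ z in 𝓝 (-1 : ℂ), complexBinom w z = (2 * Real.pi : ℂ)⁻¹ *
      (arcIntegral w (-z) Real.pi 1 - arcIntegral w (-z) (-Real.pi) 1) := by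
    filter_upwards [(isOpen_lt continuous_re continuous_const).mem_nhds
      (show (-1 : ℂ).re < 0 by norm_num)] with z hz
    have hz' : 0 < (-z).re := by simpa using hz
    have h1 := I_mul_arcIntegral_one hw hz' hpi
    have h2 := I_mul_arcIntegral_one hw hz' hpi'
    have h3 : arcIntegral w (-z) Real.pi 1 - arcIntegral w (-z) (-Real.pi) 1 =
        -2 * sin (Real.pi * z) * complexBeta (w + 1) (-z) := by
      have h4 : exp (Real.pi * I * -z) = exp (-(Real.pi * z) * I) := by ring_nf
      have h5 : exp (((-Real.pi : ℝ) : ℂ) * I * -z) = exp (Real.pi * z * I) := by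
        push_cast; ring_nf
      rw [h4] at h1
      rw [h5] at h2
      rw [sin]
      refine mul_left_cancel₀ I_ne_zero ?_
      rw [mul_sub, h1, h2]
      linear_combination (exp (-(Real.pi * z) * I) - exp (Real.pi * z * I)) *
        complexBeta (w + 1) (-z) * I_sq
    rw [h3, complexBinom_eq_beta w hz]
    have hpi : (Real.pi : ℂ) ≠ 0 := ofReal_ne_zero.2 Real.pi_ne_zero
    field_simp
  have := (differentiable_complexBinom w).differentiableOn.analyticOnNhd isOpen_univ
    |>.eq_of_eventuallyEq (hd.differentiableOn.analyticOnNhd isOpen_univ) heq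
  exact congrFun this z

/-- Log-convexity of `Γ` at `y + 1 = s(y+s) + (1-s)(y+s+1)` gives `y Γ(y) ≤ (y+s)^(1-s) Γ(y+s)`; the
factor `2` comes from `y + s ≤ 2y`. -/
lemma gamma_le_rpow_mul_gamma_add {s y : ℝ} (hs0 : 0 < s) (hs1 : s < 1) (hy : 1 ≤ y) :
    Real.Gamma y ≤ 2 * y ^ (-s) * Real.Gamma (y + s) := by
  have hy0 : 0 < y := by linarith
  have hG := Real.Gamma_pos_of_pos (add_pos hy0 hs0)
  have h := Real.Gamma_mul_add_mul_le_rpow_Gamma_mul_rpow_Gamma (s := y + s) (t := y + s + 1)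
    (a := s) (b := 1 - s) (by linarith) (by linarith) hs0 (by linarith) (by ring)
  rw [show s * (y + s) + (1 - s) * (y + s + 1) = y + 1 by ring, Real.Gamma_add_one hy0.ne',
    Real.Gamma_add_one (by positivity), Real.mul_rpow (by positivity) hG.le, mul_left_comm,
    ← Real.rpow_add hG, add_sub_cancel, Real.rpow_one] at h
  have h1 : (y + s) ^ (1 - s) ≤ 2 * y ^ (1 - s) := by
    calc (y + s) ^ (1 - s) ≤ (2 * y) ^ (1 - s) :=
          Real.rpow_le_rpow (by positivity) (by linarith) (by linarith)
      _ = 2 ^ (1 - s) * y ^ (1 - s) := Real.mul_rpow (by norm_num) hy0.le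
      _ ≤ 2 ^ (1 : ℝ) * y ^ (1 - s) := by gcongr <;> linarith
      _ = _ := by rw [Real.rpow_one]
  have h2 : y ^ (1 - s) = y * y ^ (-s) := by
    rw [sub_eq_add_neg, Real.rpow_add hy0, Real.rpow_one]
  refine le_of_mul_le_mul_left (h.trans ?_) hy0
  calc (y + s) ^ (1 - s) * Real.Gamma (y + s) ≤ 2 * y ^ (1 - s) * Real.Gamma (y + s) := by gcongr
    _ = _ := by rw [h2]; ring

/-- Taking absolute values in Euler's integral and using `(1-t)^(Re w) ≤ (1-t)^(s-1)` compares with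
the real beta function at `(Re z, s)`. -/
lemma norm_complexBeta_le {w : ℂ} {s : ℝ} (hs0 : 0 < s) (hs1 : s < 1) (hsw : s ≤ w.re + 1)
    {z : ℂ} (hz : 1 ≤ z.re) :
    ‖complexBeta (w + 1) z‖ ≤ 2 * Real.Gamma s * z.re ^ (-s) := by
  have hz0 : 0 < z.re := by linarith
  set g : ℝ → ℝ := fun t => t ^ (z.re - 1) * (1 - t) ^ (s - 1) with hg
  have hgc : ∀ t ∈ Ioc (0 : ℝ) 1, ((g t : ℝ) : ℂ) =
      (t : ℂ) ^ ((z.re : ℂ) - 1) * (1 - (t : ℂ)) ^ ((s : ℂ) - 1) := by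
    intro t ht
    rw [hg, ofReal_mul, ofReal_cpow ht.1.le, ofReal_cpow (by linarith [ht.2])]
    push_cast
    rfl
  have hgi : IntervalIntegrable g volume 0 1 := by
    have := (betaIntegral_convergent (u := z.re) (v := s) (by simpa) (by simpa)).1.re
    rw [intervalIntegrable_iff_integrableOn_Ioc_of_le zero_le_one]
    refine IntegrableOn.congr_fun this (fun t ht => ?_) measurableSet_Ioc
    rw [← hgc t ht]
    simp
  have hB : ∫ t in (0 : ℝ)..1, g t = Real.Gamma z.re * Real.Gamma s / Real.Gamma (z.re + s) := by
    have h1 := ProbabilityTheory.beta_eq_betaIntegralReal z.re s hz0 hs0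
    have h2 : betaIntegral z.re s = ((∫ t in (0 : ℝ)..1, g t : ℝ) : ℂ) := by
      rw [betaIntegral, ← intervalIntegral.integral_ofReal]
      refine integral_congr_ae (.of_forall fun t ht => ?_)
      rw [uIoc_of_le zero_le_one] at ht
      exact (hgc t ht).symm
    rw [h2, ofReal_re] at h1
    exact h1.symm
  have hle : ‖betaIntegral z (w + 1)‖ ≤ ∫ t in (0 : ℝ)..1, g t := by
    refine norm_integral_le_of_norm_le zero_le_one ?_ hgi
    filter_upwards [compl_mem_ae_iff.2 (measure_singleton (1 : ℝ))] with t ht1 ht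
    have ht' : t < 1 := lt_of_le_of_ne ht.2 ht1
    rw [norm_mul, norm_cpow_eq_rpow_re_of_pos ht.1, ← ofReal_one, ← ofReal_sub,
      norm_cpow_eq_rpow_re_of_pos (by linarith)]
    simp only [hg, sub_re, add_re, ofReal_one, one_re]
    have := ht.1
    refine mul_le_mul_of_nonneg_left ?_ (by positivity)
    exact Real.rpow_le_rpow_of_exponent_ge (by linarith) (by linarith) (by linarith)
  rw [betaIntegral_eq_Gamma_mul_div z (w + 1) hz0 (by simp; linarith), mul_comm, add_comm z] at hle
  rw [complexBeta]
  refine hle.trans (hB.le.trans ?_)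
  have hG := Real.Gamma_pos_of_pos (add_pos hz0 hs0)
  rw [div_le_iff₀ hG]
  have := gamma_le_rpow_mul_gamma_add hs0 hs1 hz
  have hGs := Real.Gamma_pos_of_pos hs0
  calc Real.Gamma z.re * Real.Gamma s ≤ 2 * z.re ^ (-s) * Real.Gamma (z.re + s) * Real.Gamma s := by
        gcongr
    _ = _ := by ring

lemma norm_sin_le (z : ℂ) : ‖sin z‖ ≤ Real.exp |z.im| := by
  rw [sin, norm_div, norm_mul, norm_I, mul_one, Complex.norm_ofNat, div_le_iff₀ two_pos]
  refine (norm_sub_le _ _).trans ?_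
  rw [norm_exp, norm_exp]
  have h1 : Real.exp ((-z * I).re) ≤ Real.exp |z.im| := Real.exp_le_exp.2 (by
    simpa using le_abs_self z.im)
  have h2 : Real.exp ((z * I).re) ≤ Real.exp |z.im| := Real.exp_le_exp.2 (by
    simpa using neg_le_abs z.im)
  linarith

lemma exists_norm_complexBinom_le {w : ℂ} (hw : -1 < w.re) :
    ∃ s C : ℝ, 0 < s ∧ 0 ≤ C ∧ ∀ z : ℂ, z.re ≤ -1 →
      ‖complexBinom w z‖ ≤ C * Real.exp (Real.pi * |z.im|) * (-z.re) ^ (-s) := by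
  -- The cap `1/2` only serves to keep `s < 1` for the log-convexity estimate.
  set s := min (1 / 2) (w.re + 1)
  have hs0 : 0 < s := lt_min (by norm_num) (by linarith)
  have hs1 : s < 1 := (min_le_left _ _).trans_lt (by norm_num)
  have hG := Real.Gamma_pos_of_pos hs0
  refine ⟨s, 2 * Real.Gamma s, hs0, by positivity, fun z hz => ?_⟩
  have h1 := norm_complexBeta_le (w := w) hs0 hs1 (min_le_right _ _) (z := -z) (by simp; linarith)
  have h2 : ‖-sin (Real.pi * z) / Real.pi‖ ≤ Real.exp (Real.pi * |z.im|) := by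
    rw [norm_div, norm_neg, norm_real, Real.norm_of_nonneg Real.pi_pos.le]
    refine (div_le_self (norm_nonneg _) (by linarith [Real.pi_gt_three])).trans ?_
    refine (norm_sin_le _).trans_eq ?_
    rw [im_ofReal_mul, abs_mul, abs_of_pos Real.pi_pos]
  rw [complexBinom_eq_beta w (by linarith), norm_mul]
  rw [neg_re] at h1
  calc _ ≤ Real.exp (Real.pi * |z.im|) * (2 * Real.Gamma s * (-z.re) ^ (-s)) := by gcongr
    _ = _ := by ring

lemma exists_isBigO_complexBinom {w : ℂ} (hw : -1 < w.re) :
    ∃ s : ℝ, 0 < s ∧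
      (fun x : ℝ => complexBinom w x) =O[cocompact ℝ] fun x : ℝ => (1 + ‖x‖) ^ (-s) := by
  obtain ⟨s, C, hs, hC, h⟩ := exists_norm_complexBinom_le hw
  have haux : ∀ x y : ℝ, (1 + ‖x‖) / 2 ≤ y → y ^ (-s) ≤ 2 ^ s * (1 + ‖x‖) ^ (-s) := by
    intro x y hxy
    have hx : 0 < 1 + ‖x‖ := by positivity
    calc y ^ (-s) ≤ ((1 + ‖x‖) / 2) ^ (-s) :=
          Real.rpow_le_rpow_of_nonpos (by positivity) hxy (by linarith)
      _ = _ := by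
        rw [Real.div_rpow hx.le (by norm_num), Real.rpow_neg two_pos.le, div_inv_eq_mul, mul_comm]
  have hnorm : ∀ x : ℝ, ‖(1 + ‖x‖) ^ (-s)‖ = (1 + ‖x‖) ^ (-s) := fun x =>
    Real.norm_of_nonneg (by positivity)
  refine ⟨s, hs, ?_⟩
  rw [cocompact_eq_atBot_atTop, isBigO_sup]
  constructor
  · refine IsBigO.of_bound (C * 2 ^ s) ?_
    filter_upwards [eventually_le_atBot (-1 : ℝ)] with x hx
    have h1 := h x (by simpa using hx)
    rw [ofReal_im, abs_zero, mul_zero, Real.exp_zero, mul_one, ofReal_re] at h1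
    rw [hnorm, mul_assoc]
    refine h1.trans (mul_le_mul_of_nonneg_left (haux _ _ ?_) hC)
    rw [Real.norm_of_nonpos (by linarith)]
    linarith
  · refine IsBigO.of_bound (C * Real.exp (Real.pi * |w.im|) * 2 ^ s) ?_
    -- The symmetry `z ↦ w - z` moves large positive `x` to the left. The first threshold gives `x -
    -- Re w ≥ (1+x)/2`, the second `Re (w - x) ≤ -1`.
    filter_upwards [eventually_ge_atTop (1 + 2 * |w.re|), eventually_ge_atTop (1 + w.re)] with x hx hx'
    have h1 := h (w - x) (by simp; linarith)
    rw [complexBinom_symm] at h1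
    simp only [sub_re, sub_im, ofReal_re, ofReal_im, sub_zero, neg_sub] at h1
    rw [hnorm, mul_assoc]
    refine h1.trans (mul_le_mul_of_nonneg_left (haux _ _ ?_) (by positivity))
    rw [Real.norm_of_nonneg (by linarith [abs_nonneg w.re])]
    linarith [le_abs_self w.re]

lemma isBigO_one_div_add (α : ℂ) :
    (fun x : ℝ => 1 / ((x : ℂ) + α)) =O[cocompact ℝ] fun x : ℝ => (1 + ‖x‖) ^ (-1 : ℝ) := by
  refine IsBigO.of_bound 2 ?_
  filter_upwards [tendsto_norm_cocompact_atTop.eventually_ge_atTop (1 + 2 * ‖α‖)] with x hx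
  have h1 : (1 + ‖x‖) / 2 ≤ ‖(x : ℂ) + α‖ := by
    have h2 : ‖(x : ℂ)‖ - ‖α‖ ≤ ‖(x : ℂ) + α‖ := by
      have := norm_sub_norm_le (x : ℂ) (-α)
      rwa [norm_neg, sub_neg_eq_add] at this
    rw [norm_real] at h2
    linarith
  have hx0 : 0 < 1 + ‖x‖ := by positivity
  rw [Real.norm_of_nonneg (by positivity), Real.rpow_neg_one, norm_div, norm_one]
  calc 1 / ‖(x : ℂ) + α‖ ≤ 1 / ((1 + ‖x‖) / 2) := one_div_le_one_div_of_le (by positivity) h1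
    _ = _ := by field_simp

lemma exists_isBigO_integrand {w : ℂ} (hw : -1 < w.re) (α : ℂ) :
    ∃ s : ℝ, 1 < s ∧ (fun x : ℝ => complexBinom w x * (1 / ((x : ℂ) + α))) =O[cocompact ℝ]
      fun x : ℝ => (1 + ‖x‖) ^ (-s) := by
  obtain ⟨s, hs, h⟩ := exists_isBigO_complexBinom hw
  refine ⟨s + 1, by linarith, (h.mul (isBigO_one_div_add α)).congr_right fun x => ?_⟩
  rw [← Real.rpow_add (by positivity)]
  ring_nf

lemma continuous_ofReal_add_inv {α : ℂ} (hα : 0 < α.im) :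
    Continuous fun x : ℝ => 1 / ((x : ℂ) + α) := by
  refine continuous_const.div (by fun_prop) fun x h => ?_
  have := congrArg im h
  simp at this
  exact hα.ne' this

lemma locallyIntegrable_integrand (w : ℂ) {α : ℂ}
    (hα : 0 < α.im ∨ ∃ n : ℕ, 1 ≤ n ∧ α = (n : ℂ)) :
    LocallyIntegrable fun x : ℝ => complexBinom w x * (1 / ((x : ℂ) + α)) := by
  have hd := differentiable_complexBinom w
  rcases hα with hα | ⟨n, hn, rfl⟩
  · exact ((hd.continuous.comp continuous_ofReal).mul
      (continuous_ofReal_add_inv hα)).locallyIntegrable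
  · have h0 : complexBinom w (-n) = 0 := by
      obtain ⟨m, rfl⟩ := Nat.exists_eq_add_of_le' hn
      rw [complexBinom_eq_inv]
      have : (-((m + 1 : ℕ) : ℂ) + 1) = -m := by push_cast; ring
      rw [this, Gamma_neg_nat_eq_zero]
      simp
    have hc : Continuous fun x : ℝ => dslope (complexBinom w) (-n) x := by
      have h1 : Continuous (dslope (complexBinom w) (-n)) := continuousOn_univ.1
        ((continuousOn_dslope univ_mem).2 ⟨hd.continuous.continuousOn, hd _⟩)
      exact h1.comp continuous_ofReal
    refine hc.locallyIntegrable.congr ?_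
    filter_upwards [compl_mem_ae_iff.2 (measure_singleton (-n : ℝ))] with x hx
    have hx' : (x : ℂ) ≠ -n := fun h => hx (by
      rw [mem_singleton_iff]; exact_mod_cast h)
    rw [dslope_of_ne _ hx', slope_def_field, h0, sub_zero, sub_neg_eq_add, mul_one_div]

theorem integrable_integrand {w α : ℂ} (hw : -1 < w.re)
    (hα : 0 < α.im ∨ ∃ n : ℕ, 1 ≤ n ∧ α = (n : ℂ)) :
    Integrable fun x : ℝ => complexBinom w x * (1 / ((x : ℂ) + α)) := by
  obtain ⟨s, hs, h⟩ := exists_isBigO_integrand hw α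
  exact (locallyIntegrable_integrand w hα).integrable_of_isBigO_cocompact h
    ((integrable_one_add_norm (by simpa using hs)).integrableAtFilter _)

/-- Absolute convergence of the series, for every `α`. -/
theorem summable_norm_series {w : ℂ} (hw : -1 < w.re) (α : ℂ) :
    Summable fun k : ℕ => ‖complexBinom w k * (1 / ((k : ℂ) + α))‖ := by
  obtain ⟨s, hs, h⟩ := exists_isBigO_integrand hw α
  have h1 : Tendsto (fun k : ℕ => (k : ℝ)) atTop (cocompact ℝ) :=
    tendsto_natCast_atTop_atTop.mono_right atTop_le_cocompact
  have h2 := (h.comp_tendsto h1).norm_left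
  refine summable_of_isBigO_nat ((summable_nat_add_iff 1).2 (Real.summable_nat_rpow.2
    (neg_lt_neg hs))) (h2.congr (fun k => ?_) (fun k => ?_))
  · simp
  · simp [add_comm]

end ComplexBinom

/-! ### The integral by Fourier inversion. -/

namespace ComplexBinom

open Complex MeasureTheory Set Filter Topology intervalIntegral FourierTransform Convolution

/-- The function whose Fourier transform is `x ↦ complexBinom w x`. -/
noncomputable def binomKernel (w : ℂ) : ℝ → ℂ :=
  indicator (Ioc (-(1 / 2)) (1 / 2)) fun t => (1 + exp ((2 * Real.pi * t : ℝ) * I)) ^ w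

/-- The function whose Fourier transform is `x ↦ 1 / (x + α)` for `0 < im α`. -/
noncomputable def poleKernel (α : ℂ) : ℝ → ℂ :=
  indicator (Iic 0) fun t => -(2 * Real.pi * I) * exp (-(2 * Real.pi * I * α) * t)

lemma intervalIntegrable_circle {w : ℂ} (hw : -1 < w.re) (α : ℂ) :
    IntervalIntegrable (fun s : ℝ => (1 + exp (s * I)) ^ w * exp (s * I * α)) volume
      (-Real.pi) Real.pi := by
  have hpi : |Real.pi| = Real.pi := abs_of_pos Real.pi_pos
  have h1 := intervalIntegrable_arc hw α hpi zero_le_one le_rfl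
  have h2 := intervalIntegrable_arc hw α (by rwa [abs_neg]) zero_le_one le_rfl (θ := -Real.pi)
  simp only [ofReal_one, one_mul] at h1 h2
  exact h2.symm.trans h1

lemma complexBinom_eq_integral {w : ℂ} (hw : -1 < w.re) (z : ℂ) :
    complexBinom w z = (2 * Real.pi : ℂ)⁻¹ *
      ∫ s in -Real.pi..Real.pi, (1 + exp (s * I)) ^ w * exp (s * I * -z) := by
  have hpi : |Real.pi| = Real.pi := abs_of_pos Real.pi_pos
  have h1 := intervalIntegrable_arc hw (-z) hpi zero_le_one le_rfl
  have h2 := intervalIntegrable_arc hw (-z) (by rwa [abs_neg]) zero_le_one le_rfl (θ := -Real.pi)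
  rw [complexBinom_eq_arcIntegral_sub hw, arcIntegral, arcIntegral,
    integral_interval_sub_left h1 h2]
  simp only [ofReal_one, one_mul]

lemma integrable_binomKernel {w : ℂ} (hw : -1 < w.re) : Integrable (binomKernel w) := by
  rw [binomKernel, integrable_indicator_iff measurableSet_Ioc,
    ← intervalIntegrable_iff_integrableOn_Ioc_of_le (by norm_num)]
  have h := intervalIntegrable_circle hw 0
  simp only [mul_zero, exp_zero, mul_one] at h
  have h2 := h.comp_mul_left (c := 2 * Real.pi)
  have hpi := Real.pi_ne_zero
  rw [show -Real.pi / (2 * Real.pi) = -(1 / 2) by field_simp,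
    show Real.pi / (2 * Real.pi) = 1 / 2 by field_simp] at h2
  exact h2

lemma fourier_binomKernel {w : ℂ} (hw : -1 < w.re) (x : ℝ) :
    𝓕 (binomKernel w) x = complexBinom w x := by
  have hpi := Real.pi_ne_zero
  rw [Real.fourier_real_eq_integral_exp_smul, complexBinom_eq_integral hw]
  have h1 : ∀ t : ℝ, exp ((-2 * Real.pi * t * x : ℝ) * I) • binomKernel w t =
      indicator (Ioc (-(1 / 2)) (1 / 2)) (fun t : ℝ =>
        (1 + exp ((2 * Real.pi * t : ℝ) * I)) ^ w * exp ((2 * Real.pi * t : ℝ) * I * -x)) t := by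
    intro t
    rw [binomKernel, smul_eq_mul]
    by_cases ht : t ∈ Ioc (-(1 / 2) : ℝ) (1 / 2)
    · rw [indicator_of_mem ht, indicator_of_mem ht, mul_comm]
      congr 2
      push_cast
      ring
    · rw [indicator_of_notMem ht, indicator_of_notMem ht, mul_zero]
  simp_rw [h1]
  rw [MeasureTheory.integral_indicator measurableSet_Ioc, ← integral_of_le (by norm_num),
    integral_comp_mul_left (fun s : ℝ => (1 + exp (s * I)) ^ w * exp (s * I * -x))
      (mul_ne_zero two_ne_zero hpi),
    show 2 * Real.pi * -(1 / 2) = -Real.pi by ring, show 2 * Real.pi * (1 / 2) = Real.pi by ring,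
    real_smul]
  push_cast
  rfl

lemma poleKernel_exponent_re {α β : ℂ} (hβ : β.im = α.im) :
    (-(2 * Real.pi * I * β)).re = 2 * Real.pi * α.im := by
  rw [← hβ]
  simp [mul_re, mul_im]

lemma integrable_poleKernel {α : ℂ} (hα : 0 < α.im) : Integrable (poleKernel α) := by
  rw [poleKernel, integrable_indicator_iff measurableSet_Iic]
  refine Integrable.const_mul (integrableOn_exp_mul_complex_Iic ?_ 0) _
  rw [poleKernel_exponent_re rfl]
  have := Real.pi_pos
  positivity

lemma fourier_poleKernel {α : ℂ} (hα : 0 < α.im) (x : ℝ) :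
    𝓕 (poleKernel α) x = 1 / ((x : ℂ) + α) := by
  have hpi := Real.pi_pos
  rw [Real.fourier_real_eq_integral_exp_smul]
  have h1 : ∀ t : ℝ, exp ((-2 * Real.pi * t * x : ℝ) * I) • poleKernel α t =
      indicator (Iic 0) (fun t : ℝ =>
        -(2 * Real.pi * I) * exp (-(2 * Real.pi * I * (x + α)) * t)) t := by
    intro t
    rw [poleKernel, smul_eq_mul]
    by_cases ht : t ∈ Iic (0 : ℝ)
    · rw [indicator_of_mem ht, indicator_of_mem ht, mul_left_comm, ← exp_add]
      congr 2
      push_cast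
      ring
    · rw [indicator_of_notMem ht, indicator_of_notMem ht, mul_zero]
  simp_rw [h1]
  have him : ((x : ℂ) + α).im = α.im := by simp
  have hne : (x : ℂ) + α ≠ 0 := fun h => by
    rw [h, zero_im] at him
    exact hα.ne him
  rw [MeasureTheory.integral_indicator measurableSet_Iic, MeasureTheory.integral_const_mul,
    integral_exp_mul_complex_Iic (by rw [poleKernel_exponent_re him]; positivity)]
  have hpi' : (Real.pi : ℂ) ≠ 0 := ofReal_ne_zero.2 hpi.ne'
  rw [ofReal_zero, mul_zero, exp_zero]
  field_simp

lemma norm_poleKernel_le {α : ℂ} (hα : 0 < α.im) (t : ℝ) :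
    ‖poleKernel α t‖ ≤ 2 * Real.pi := by
  have hpi := Real.pi_pos
  by_cases ht : t ∈ Iic (0 : ℝ)
  · rw [poleKernel, indicator_of_mem ht, norm_mul, norm_exp, re_mul_ofReal,
      poleKernel_exponent_re rfl]
    have h1 : ‖-(2 * Real.pi * I : ℂ)‖ = 2 * Real.pi := by
      simp [abs_of_pos hpi]
    rw [h1]
    refine mul_le_of_le_one_right (by positivity) (Real.exp_le_one_iff.2 ?_)
    exact mul_nonpos_of_nonneg_of_nonpos (by positivity) ht
  · rw [poleKernel, indicator_of_notMem ht, norm_zero]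
    positivity

lemma measurable_poleKernel (α : ℂ) : Measurable (poleKernel α) :=
  Measurable.indicator (by fun_prop) measurableSet_Iic

lemma continuousAt_poleKernel (α : ℂ) {t : ℝ} (ht : t ≠ 0) : ContinuousAt (poleKernel α) t := by
  rcases ht.lt_or_gt with h | h
  · have : poleKernel α =ᶠ[𝓝 t]
        fun t : ℝ => -(2 * Real.pi * I) * exp (-(2 * Real.pi * I * α) * t) := by
      filter_upwards [Iio_mem_nhds h] with u hu
      exact indicator_of_mem (mem_Iic.2 (le_of_lt hu)) _
    refine ContinuousAt.congr ?_ this.symm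
    fun_prop
  · have : poleKernel α =ᶠ[𝓝 t] fun _ => 0 := by
      filter_upwards [Ioi_mem_nhds h] with u hu
      exact indicator_of_notMem (notMem_Iic.2 hu) _
    exact continuousAt_const.congr this.symm

/-- Supplies the continuity that pointwise inversion at `0` requires. `binomKernel` may be
unbounded, but it is integrable, and `poleKernel` is bounded with a single jump, so dominated
convergence applies. -/
lemma continuousAt_convolution_kernels {w α : ℂ} (hw : -1 < w.re) (hα : 0 < α.im) :
    ContinuousAt (binomKernel w ⋆[ContinuousLinearMap.mul ℂ ℂ] poleKernel α) 0 := by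
  have hG := integrable_binomKernel hw
  refine continuousAt_of_dominated (bound := fun t => ‖binomKernel w t‖ * (2 * Real.pi))
    (.of_forall fun y => ?_) (.of_forall fun y => .of_forall fun t => ?_) (hG.norm.mul_const _) ?_
  · exact hG.aestronglyMeasurable.mul
      ((measurable_poleKernel α).comp (measurable_const.sub measurable_id)).aestronglyMeasurable
  · rw [ContinuousLinearMap.mul_apply', norm_mul]
    exact mul_le_mul_of_nonneg_left (norm_poleKernel_le hα _) (norm_nonneg _)
  · filter_upwards [compl_mem_ae_iff.2 (measure_singleton (0 : ℝ))] with t ht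
    have h1 : ContinuousAt (fun y : ℝ => poleKernel α (y - t)) 0 :=
      ContinuousAt.comp (f := fun y : ℝ => y - t)
        (continuousAt_poleKernel α (by simpa using ht)) (by fun_prop)
    exact continuousAt_const.mul h1

lemma convolution_kernels_zero (w α : ℂ) :
    (binomKernel w ⋆[ContinuousLinearMap.mul ℂ ℂ] poleKernel α) 0 =
      -I * arcIntegral w α Real.pi 1 := by
  have hpi := Real.pi_ne_zero
  -- `poleKernel α (-t)` vanishes for `t < 0`, which leaves the upper half of the circle. At `t = 0`
  -- the equality can fail, since the closed half-line contains `0` and `Ioc` does not; this is a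
  -- null set.
  have h1 : ∀ t : ℝ, t ≠ 0 → ContinuousLinearMap.mul ℂ ℂ (binomKernel w t) (poleKernel α (0 - t)) =
      indicator (Ioc 0 (1 / 2)) (fun t : ℝ => -(2 * Real.pi * I) *
        ((1 + ((1 : ℝ) : ℂ) * exp ((2 * Real.pi * t : ℝ) * I)) ^ w *
          exp ((2 * Real.pi * t : ℝ) * I * α))) t := by
    intro t ht
    rw [ContinuousLinearMap.mul_apply', binomKernel, poleKernel]
    by_cases h0 : 0 < t
    · rw [indicator_of_mem (s := Iic 0) (by simpa using h0.le)]
      by_cases h2 : t ≤ 1 / 2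
      · rw [indicator_of_mem (show t ∈ Ioc (-(1 / 2) : ℝ) (1 / 2) from ⟨by linarith, h2⟩),
          indicator_of_mem (show t ∈ Ioc (0 : ℝ) (1 / 2) from ⟨h0, h2⟩), mul_left_comm]
        push_cast
        rw [one_mul]
        congr 3
        ring
      · rw [indicator_of_notMem (fun h => h2 h.2), indicator_of_notMem (fun h => h2 h.2), zero_mul]
    · have hlt : t < 0 := lt_of_le_of_ne (not_lt.1 h0) ht
      rw [indicator_of_notMem (s := Iic 0) (by simpa using hlt),
        indicator_of_notMem (s := Ioc 0 (1 / 2)) (fun h => h0 h.1), mul_zero]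
  rw [convolution_def]
  have h2 : ∀ᵐ t : ℝ, t ≠ 0 := compl_mem_ae_iff.2 (measure_singleton (0 : ℝ))
  rw [integral_congr_ae (h2.mono h1), MeasureTheory.integral_indicator measurableSet_Ioc,
    ← integral_of_le (by norm_num), intervalIntegral.integral_const_mul,
    integral_comp_mul_left
      (fun s : ℝ => (1 + ((1 : ℝ) : ℂ) * exp (s * I)) ^ w * exp (s * I * α))
      (mul_ne_zero two_ne_zero hpi), mul_zero, show 2 * Real.pi * (1 / 2) = Real.pi by ring,
    real_smul, arcIntegral, ← mul_assoc]
  congr 1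
  push_cast
  field_simp

theorem integral_eq_arcIntegral_of_im_pos {w α : ℂ} (hw : -1 < w.re) (hα : 0 < α.im) :
    ∫ x : ℝ, complexBinom w x * (1 / ((x : ℂ) + α)) = -I * arcIntegral w α Real.pi 1 := by
  have hG := integrable_binomKernel hw
  have hH := integrable_poleKernel hα
  have hF : 𝓕 (binomKernel w ⋆[ContinuousLinearMap.mul ℂ ℂ] poleKernel α) =
      fun x : ℝ => complexBinom w x * (1 / ((x : ℂ) + α)) := by
    funext x
    rw [Real.fourier_mul_convolution_eq hG hH, fourier_binomKernel hw, fourier_poleKernel hα]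
  have hinv := (hG.integrable_convolution (ContinuousLinearMap.mul ℂ ℂ) hH).fourierInv_fourier_eq
    (by rw [hF]; exact integrable_integrand hw (Or.inl hα))
    (continuousAt_convolution_kernels hw hα)
  rw [hF, convolution_kernels_zero, Real.fourierInv_eq'] at hinv
  rw [← hinv]
  simp

theorem integral_eq_arcIntegral {w α : ℂ} (hw : -1 < w.re)
    (hα : 0 < α.im ∨ ∃ n : ℕ, 1 ≤ n ∧ α = (n : ℂ)) :
    ∫ x : ℝ, complexBinom w x * (1 / ((x : ℂ) + α)) = -I * arcIntegral w α Real.pi 1 := by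
  rcases hα with hα | hn
  · exact integral_eq_arcIntegral_of_im_pos hw hα
  have hint := integrable_integrand hw (Or.inr hn)
  obtain ⟨n, -, rfl⟩ := hn
  have hpath : Tendsto (fun ε : ℝ => (n : ℂ) + ε * I) (𝓝[>] 0) (𝓝 n) := by
    have : ContinuousAt (fun ε : ℝ => (n : ℂ) + ε * I) 0 := by fun_prop
    simpa [ContinuousAt] using this.tendsto.mono_left (nhdsWithin_le_nhds (s := Ioi 0))
  have hne : ∀ᵐ x : ℝ, (x : ℂ) + n ≠ 0 := by
    filter_upwards [compl_mem_ae_iff.2 (measure_singleton (-n : ℝ))] with x hx h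
    refine hx ?_
    rw [mem_singleton_iff]
    exact_mod_cast eq_neg_of_add_eq_zero_left h
  have h1 : Tendsto (fun ε : ℝ => ∫ x : ℝ, complexBinom w x * (1 / ((x : ℂ) + (n + ε * I))))
      (𝓝[>] 0) (𝓝 (∫ x : ℝ, complexBinom w x * (1 / ((x : ℂ) + n)))) := by
    -- Since `|x + n + iε| ≥ |x + n|`, the limiting integrand itself dominates.
    refine tendsto_integral_filter_of_dominated_convergence _ ?_ ?_ hint.norm ?_
    · filter_upwards [self_mem_nhdsWithin] with ε hε
      exact (integrable_integrand hw (Or.inl (by simpa using hε))).aestronglyMeasurable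
    · refine .of_forall fun ε => ?_
      filter_upwards [hne] with x hx
      rw [norm_mul, norm_mul, norm_div, norm_div]
      have : ‖(x : ℂ) + n‖ ≤ ‖(x : ℂ) + (n + ε * I)‖ := by
        have h2 := abs_re_le_norm ((x : ℂ) + (n + ε * I))
        have h3 : ((x : ℂ) + n) = ((x + n : ℝ) : ℂ) := by push_cast; rfl
        rw [h3, norm_real]
        simpa using h2
      have := norm_pos_iff.2 hx
      gcongr
    · filter_upwards [hne] with x hx
      exact (((hpath.const_add _).inv₀ hx).congr fun ε => (one_div _).symm).const_mul _ |>.trans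
        (by rw [one_div])
  have h2 : Tendsto (fun ε : ℝ => -I * arcIntegral w (n + ε * I) Real.pi 1) (𝓝[>] 0)
      (𝓝 (-I * arcIntegral w n Real.pi 1)) :=
    (((differentiable_arcIntegral hw (abs_of_pos Real.pi_pos)).continuous.tendsto n).comp
      hpath).const_mul _
  refine tendsto_nhds_unique (h1.congr' ?_) h2
  filter_upwards [self_mem_nhdsWithin] with ε hε
  exact integral_eq_arcIntegral_of_im_pos hw (by simpa using hε)

end ComplexBinom

/-! ### The series: termwise integration and analytic continuation in `α`. -/

namespace ComplexBinom

open Complex MeasureTheory Set Filter Topology intervalIntegral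

lemma complexBinom_zero {w : ℂ} (hw : -1 < w.re) : complexBinom w 0 = 1 := by
  have h : Gamma (w + 1) ≠ 0 := Gamma_ne_zero_of_re_pos (by simp; linarith)
  rw [complexBinom, zero_add, Gamma_one, one_mul, sub_zero, div_self h]

/-- The recurrence of the reciprocal Gamma function holds at the poles of `Γ` too, so no exceptional
`z` arise. -/
lemma complexBinom_succ (w z : ℂ) :
    (z + 1) * complexBinom w (z + 1) = complexBinom w z * (w - z) := by
  have h1 := one_div_Gamma_eq_self_mul_one_div_Gamma_add_one (z + 1)
  have h2 := one_div_Gamma_eq_self_mul_one_div_Gamma_add_one (w - z)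
  rw [complexBinom_eq_inv, complexBinom_eq_inv, h1, show w - (z + 1) + 1 = w - z by ring, h2]
  ring

lemma factorial_mul_complexBinom {w : ℂ} (hw : -1 < w.re) (k : ℕ) :
    (k.factorial : ℂ) * complexBinom w k = (descPochhammer ℤ k).smeval w := by
  induction k with
  | zero => simp [complexBinom_zero hw]
  | succ k ih =>
    have h : (descPochhammer ℤ (k + 1)).smeval w =
        (descPochhammer ℤ k).smeval w * (w - k) := by
      simp [descPochhammer_succ_right, Polynomial.smeval_mul, Polynomial.smeval_natCast]
    have h2 := complexBinom_succ w k
    rw [h, ← ih, Nat.factorial_succ]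
    push_cast
    linear_combination (k.factorial : ℂ) * h2

lemma complexBinom_natCast {w : ℂ} (hw : -1 < w.re) (k : ℕ) :
    complexBinom w k = Ring.choose w k := by
  have h1 := Ring.descPochhammer_eq_factorial_smul_choose w k
  rw [← factorial_mul_complexBinom hw, nsmul_eq_mul] at h1
  exact mul_left_cancel₀ (Nat.cast_ne_zero.2 k.factorial_ne_zero) h1

lemma hasSum_one_add_cpow {w : ℂ} (hw : -1 < w.re) {t : ℂ} (ht : ‖t‖ < 1) :
    HasSum (fun k : ℕ => complexBinom w k * t ^ k) ((1 + t) ^ w) := by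
  have hmem : t ∈ Metric.eball (0 : ℂ) 1 := by
    rw [← ENNReal.ofReal_one, Metric.eball_ofReal]
    simpa using ht
  have h := (one_add_cpow_hasFPowerSeriesOnBall_zero (a := w)).hasSum hmem
  simp only [zero_add] at h
  have hterm : ∀ k : ℕ, (binomialSeries ℂ w k fun _ => t) = complexBinom w k * t ^ k := fun k => by
    rw [binomialSeries_apply, complexBinom_natCast hw, smul_eq_mul, List.ofFn_const,
      List.prod_replicate]
  rwa [funext hterm] at h

/-- Termwise integration of the binomial series of `(1+t)^w` on the open interval, where `|t| < 1`.
The `L¹` norms of the terms are the norms of the terms of the same series at `Re α`, hence summable.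
-/
lemma plusIntegral_eq_tsum {w α : ℂ} (hw : -1 < w.re) (hα : 0 < α.re) :
    plusIntegral w α = ∑' k : ℕ, complexBinom w k * (1 / ((k : ℂ) + α)) := by
  have hmul : ∀ (k : ℕ) (t : ℝ), t ∈ Ioo (0 : ℝ) 1 →
      (t : ℂ) ^ (α - 1) * (complexBinom w k * (t : ℂ) ^ k) =
        complexBinom w k * (t : ℂ) ^ (α - 1 + k) := by
    intro k t ht
    rw [cpow_add _ _ (ofReal_ne_zero.2 ht.1.ne'), cpow_natCast]
    ring
  have hre : ∀ k : ℕ, -1 < (α - 1 + k).re := by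
    intro k
    simp only [add_re, sub_re, one_re, natCast_re]
    have : (0 : ℝ) ≤ k := k.cast_nonneg
    linarith
  have hint : ∀ k : ℕ, IntegrableOn
      (fun t : ℝ => complexBinom w k * (t : ℂ) ^ (α - 1 + k)) (Ioo 0 1) := by
    intro k
    have := (intervalIntegrable_cpow' (a := 0) (b := 1) (hre k)).const_mul (complexBinom w k)
    exact ((intervalIntegrable_iff_integrableOn_Ioo_of_le zero_le_one).1 this)
  have key := hasSum_integral_of_summable_integral_norm (μ := volume.restrict (Ioo (0 : ℝ) 1))
    (F := fun (k : ℕ) (t : ℝ) => (t : ℂ) ^ (α - 1) * (complexBinom w k * (t : ℂ) ^ k)) ?_ ?_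
  · have h1 : ∀ k : ℕ, ∫ t in Ioo (0 : ℝ) 1,
        (t : ℂ) ^ (α - 1) * (complexBinom w k * (t : ℂ) ^ k) =
          complexBinom w k * (1 / ((k : ℂ) + α)) := by
      intro k
      rw [setIntegral_congr_fun measurableSet_Ioo (hmul k), MeasureTheory.integral_const_mul,
        ← integral_Ioc_eq_integral_Ioo, ← integral_of_le zero_le_one, integral_cpow (Or.inl (hre k)),
        show α - 1 + k + 1 = k + α by ring, ofReal_one, one_cpow, ofReal_zero, zero_cpow, sub_zero]
      intro h
      have := hre k
      rw [show α - 1 + k = (k + α) - 1 by ring, h] at this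
      simp at this
    have h2 : ∫ t in Ioo (0 : ℝ) 1,
        ∑' k : ℕ, (t : ℂ) ^ (α - 1) * (complexBinom w k * (t : ℂ) ^ k) = plusIntegral w α := by
      rw [plusIntegral, integral_of_le zero_le_one, integral_Ioc_eq_integral_Ioo]
      refine setIntegral_congr_fun measurableSet_Ioo fun t ht => ?_
      rw [tsum_mul_left, one_mul, (hasSum_one_add_cpow hw _).tsum_eq]
      rw [norm_real, Real.norm_of_nonneg ht.1.le]
      exact ht.2
    simp only [h1, h2] at key
    exact key.tsum_eq.symm
  · intro k
    exact (hint k).congr_fun (fun t ht => (hmul k t ht).symm) measurableSet_Ioo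
  · refine (summable_norm_series hw (α.re : ℂ)).congr fun k => ?_
    have h1 : ∀ t ∈ Ioo (0 : ℝ) 1, ‖(t : ℂ) ^ (α - 1) * (complexBinom w k * (t : ℂ) ^ k)‖ =
        ‖complexBinom w k‖ * t ^ ((α - 1 + k).re) := by
      intro t ht
      rw [hmul k t ht, norm_mul, norm_cpow_eq_rpow_re_of_pos ht.1]
    have hpos : 0 < (k : ℝ) + α.re := by positivity
    have h3 : (α - 1 + k).re + 1 = k + α.re := by simp; ring
    rw [setIntegral_congr_fun measurableSet_Ioo h1, MeasureTheory.integral_const_mul,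
      ← integral_Ioc_eq_integral_Ioo, ← integral_of_le zero_le_one, integral_rpow (Or.inl (hre k)),
      h3, Real.one_rpow, Real.zero_rpow hpos.ne', sub_zero, norm_mul, norm_div, norm_one,
      ← ofReal_natCast, ← ofReal_add, norm_real, Real.norm_of_nonneg hpos.le]

lemma ne_neg_natCast_of_im_pos {α : ℂ} (hα : 0 < α.im) (m : ℕ) : α ≠ -m := by
  rintro rfl
  simp at hα

lemma differentiableOn_tsum {w : ℂ} (hw : -1 < w.re) :
    DifferentiableOn ℂ (fun α => ∑' k : ℕ, complexBinom w k * (1 / ((k : ℂ) + α)))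
      {α | 0 < α.im} := by
  intro α₀ (hα₀ : 0 < α₀.im)
  -- As `|k + α₀| ≥ Im α₀`, moving `α` by less than `Im α₀ / 2` at most halves the denominator, so
  -- twice the series at `α₀` is a uniform majorant.
  have hball : ∀ α ∈ Metric.ball α₀ (α₀.im / 2), ∀ k : ℕ,
      ‖(k : ℂ) + α₀‖ / 2 ≤ ‖(k : ℂ) + α‖ ∧ 0 < ‖(k : ℂ) + α₀‖ := by
    intro α hα k
    rw [mem_ball_iff_norm] at hα
    have h1 := abs_im_le_norm ((k : ℂ) + α₀)
    have h2 : ((k : ℂ) + α₀).im = α₀.im := by simp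
    rw [h2, abs_of_pos hα₀] at h1
    have h3 := norm_sub_norm_le ((k : ℂ) + α₀) ((k : ℂ) + α)
    rw [add_sub_add_left_eq_sub, norm_sub_rev] at h3
    constructor <;> linarith
  have hd : DifferentiableOn ℂ (fun α => ∑' k : ℕ, complexBinom w k * (1 / ((k : ℂ) + α)))
      (Metric.ball α₀ (α₀.im / 2)) := by
    refine differentiableOn_tsum_of_summable_norm ((summable_norm_series hw α₀).mul_left 2)
      (fun k α hα => ?_) Metric.isOpen_ball fun k α hα => ?_
    · have h := hball α hα k
      have hne : (k : ℂ) + α ≠ 0 := norm_pos_iff.1 (by linarith)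
      have : DifferentiableAt ℂ (fun α => complexBinom w k * (1 / ((k : ℂ) + α))) α := by
        fun_prop (disch := exact hne)
      exact this.differentiableWithinAt
    · have h := hball α hα k
      have h0 := h.2
      rw [norm_mul, norm_mul, norm_div, norm_div, norm_one]
      calc ‖complexBinom w k‖ * (1 / ‖(k : ℂ) + α‖)
          ≤ ‖complexBinom w k‖ * (1 / (‖(k : ℂ) + α₀‖ / 2)) := by
            gcongr
            exact h.1
        _ = _ := by field_simp
  exact (hd.differentiableAt (Metric.ball_mem_nhds _ (by linarith))).differentiableWithinAt

lemma differentiableOn_complexBeta (w : ℂ) :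
    DifferentiableOn ℂ (fun α => exp (Real.pi * I * α) * complexBeta (w + 1) α) {α | 0 < α.im} := by
  intro α hα
  have h1 : DifferentiableAt ℂ (fun α => complexBeta (w + 1) α) α := by
    simp only [complexBeta, div_eq_mul_inv]
    refine DifferentiableAt.mul ((differentiableAt_Gamma α
      (ne_neg_natCast_of_im_pos hα)).const_mul _) ?_
    exact (differentiable_one_div_Gamma.comp (differentiable_id.const_add (w + 1))) α
  exact (DifferentiableAt.mul (by fun_prop) h1).differentiableWithinAt

theorem arcIntegral_eq_tsum {w α : ℂ} (hw : -1 < w.re)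
    (hα : 0 < α.im ∨ ∃ n : ℕ, 1 ≤ n ∧ α = (n : ℂ)) :
    -I * arcIntegral w α Real.pi 1 = (∑' k : ℕ, complexBinom w k * (1 / ((k : ℂ) + α))) -
      exp (Real.pi * I * α) * complexBeta (w + 1) α := by
  have hpi : |Real.pi| = Real.pi := abs_of_pos Real.pi_pos
  have hright : ∀ {α : ℂ}, 0 < α.re → -I * arcIntegral w α Real.pi 1 =
      (∑' k : ℕ, complexBinom w k * (1 / ((k : ℂ) + α))) -
        exp (Real.pi * I * α) * complexBeta (w + 1) α := by
    intro α hα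
    rw [neg_mul, I_mul_arcIntegral_one hw hα hpi, ← plusIntegral_eq_tsum hw hα, neg_sub]
  rcases hα with hα | ⟨n, hn, rfl⟩
  · have hopen : IsOpen {α : ℂ | 0 < α.im} := isOpen_lt continuous_const continuous_im
    have h1 : AnalyticOnNhd ℂ (fun α => -I * arcIntegral w α Real.pi 1) {α | 0 < α.im} :=
      ((differentiable_arcIntegral hw hpi).const_mul (-I)).differentiableOn.analyticOnNhd hopen
    have h2 := ((differentiableOn_tsum hw).sub
      (differentiableOn_complexBeta w)).analyticOnNhd hopen
    -- The base point `1 + I` lies in both half-planes, `Im > 0` and `Re > 0`.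
    refine h1.eqOn_of_preconnected_of_eventuallyEq h2 (convex_halfSpace_im_gt 0).isPreconnected
      (z₀ := 1 + I) (by simp) ?_ hα
    filter_upwards [(isOpen_lt continuous_const continuous_re).mem_nhds
      (show 0 < (1 + I).re by simp)] with β hβ
    exact hright hβ
  · refine hright ?_
    rw [natCast_re]
    exact_mod_cast hn

end ComplexBinom

theorem mainTheorem9 (w α : ℂ) (hw : -1 < w.re)
    (hα : 0 < α.im ∨ ∃ n : ℕ, 1 ≤ n ∧ α = (n : ℂ)) :
    MeasureTheory.Integrable (fun x : ℝ => complexBinom w (x : ℂ) * (1 / ((x : ℂ) + α))) ∧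
    Summable (fun k : ℕ => complexBinom w (k : ℂ) * (1 / ((k : ℂ) + α))) ∧
    ∫ x : ℝ, complexBinom w (x : ℂ) * (1 / ((x : ℂ) + α)) =
      (∑' k : ℕ, complexBinom w (k : ℂ) * (1 / ((k : ℂ) + α))) -
        Complex.exp (Complex.I * (Real.pi : ℂ) * α) * complexBeta (w + 1) α := by
  refine ⟨ComplexBinom.integrable_integrand hw hα,
    (ComplexBinom.summable_norm_series hw α).of_norm, ?_⟩
  rw [ComplexBinom.integral_eq_arcIntegral hw hα, ComplexBinom.arcIntegral_eq_tsum hw hα,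
    mul_comm (Real.pi : ℂ) Complex.I]
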